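/- Let $H$ denote Shannon entropy, $I(U:V)=H(U)-H(U|V)$ mutual information and $I(U:V|W)=H(U|W)-H(U|V,W)$ conditional mutual information. There are an absolute constant $C$ and, for every real $M$, a constant $C_M$ depending only on $M$, such that the following holds for all jointly distributed discrete (finitely or countably valued) random variables $X,Y,A,B$ of finite entropy and every real $\epsilon\ge 0$ with \[ \max\{I(X:Y|A),\,I(A:Y|X)\}\le \epsilon\cdot I(X:A). \] First, \[ I(X:Y)\le I(X:Y|A)+I(X:Y|B)+I(A:B)+C\sqrt{\epsilon}\cdot I(X:A). \] Second, whenever $\epsilon\le M$, \[ I(X:Y)\le I(X:Y|B)+I(A:B)+C_M\sqrt{\epsilon}\cdot I(X:A). \] -/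

import Mathlib

open MeasureTheory

namespace InfoIneq

/-- Shannon entropy `H(X) = - ∑ₓ Pr[X = x] log Pr[X = x]` (in nats) of a discrete random
variable. The sum is meaningful when `HasFiniteEntropy μ X` holds. -/
noncomputable def entropy {Ω S : Type*} [MeasurableSpace Ω] (μ : Measure Ω) (X : Ω → S) : ℝ :=
  ∑' x : S, Real.negMulLog (μ.real (X ⁻¹' {x}))

/-- The discrete random variable `X` has finite entropy: the nonnegative series defining its
entropy converges. This is automatic when `X` takes values in a finite set. -/
def HasFiniteEntropy {Ω S : Type*} [MeasurableSpace Ω] (μ : Measure Ω) (X : Ω → S) : Prop :=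
  Summable fun x : S => Real.negMulLog (μ.real (X ⁻¹' {x}))

/-- Conditional entropy `H(X|Y) = H(X,Y) - H(Y)`. -/
noncomputable def condEntropy {Ω S T : Type*} [MeasurableSpace Ω] (μ : Measure Ω)
    (X : Ω → S) (Y : Ω → T) : ℝ :=
  entropy μ (fun ω => (X ω, Y ω)) - entropy μ Y

/-- Mutual information `I(X:Y) = H(X) - H(X|Y)`. -/
noncomputable def mutualInfo {Ω S T : Type*} [MeasurableSpace Ω] (μ : Measure Ω)
    (X : Ω → S) (Y : Ω → T) : ℝ :=
  entropy μ X - condEntropy μ X Y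

/-- Conditional mutual information `I(X:Y|Z) = H(X|Z) - H(X|Y,Z)`. -/
noncomputable def condMutualInfo {Ω S T U : Type*} [MeasurableSpace Ω] (μ : Measure Ω)
    (X : Ω → S) (Y : Ω → T) (Z : Ω → U) : ℝ :=
  condEntropy μ X Z - condEntropy μ X (fun ω => (Y ω, Z ω))

end InfoIneq

/-! Put D = I(X:Y) - I(X:Y|B) - I(A:B) and δ = ε·I(X:A). Keep a copy W of X and run a chain X → A →
X → A → ... that resamples with Y held fixed: A from its law given (X,Y), then X from its law given
(A,Y). The pairs (W,Y) and (current X,Y) always keep the law of (X,Y).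

Two quantities are tracked. The leakage I(W:Y|X) starts at 0 and grows by at most I(X:Y|A) +
I(A:Y|X) ≤ 2δ per double move (`condMutualInfo_step_le`). The memory I(W:X|Y) decreases by data
processing. An Ingleton-type inequality (`mutualInfo_le_of_markov`) bounds D by leakage plus the
drop in memory.

Over k double moves the memory telescopes, from a value at most I(X:A|Y) ≤ (1+ε)·I(X:A), and the
leakage sums to O(k²)δ (`mul_le_of_isSelfCoupling`). Taking k of order 1/√ε gives the second
inequality for ε ≤ 1; the first is then weaker. For ε ≥ 1 both follow from I(X:Y) ≤ I(X:A) +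
I(X:Y|A). -/

namespace InfoIneq

/-! ### Entropy as an average over atoms, and submodularity. -/

section Calculus

variable {Ω : Type*} [MeasurableSpace Ω] {μ : Measure Ω}

/-- The probability of the value that `X` takes at `ω`. -/
noncomputable def fiberProb (μ : Measure Ω) {S : Type*} (X : Ω → S) (ω : Ω) : ℝ :=
  μ.real (X ⁻¹' {X ω})

theorem fiberProb_nonneg {S : Type*} (X : Ω → S) (ω : Ω) : 0 ≤ fiberProb μ X ω :=
  measureReal_nonneg

theorem fiberProb_le_one [IsProbabilityMeasure μ] {S : Type*} (X : Ω → S) (ω : Ω) :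
    fiberProb μ X ω ≤ 1 := measureReal_le_one

theorem fiberProb_mono [IsProbabilityMeasure μ] {S T : Type*} {X : Ω → S} {Y : Ω → T}
    (h : ∀ ω ω', X ω = X ω' → Y ω = Y ω') (ω : Ω) : fiberProb μ X ω ≤ fiberProb μ Y ω :=
  measureReal_mono (fun ω' hω' => h ω' ω hω')

theorem fiberProb_pos [IsProbabilityMeasure μ] {S : Type*} (X : Ω → S) {ω : Ω}
    (h : 0 < μ.real {ω}) : 0 < fiberProb μ X ω :=
  h.trans_le (measureReal_mono (by intro a ha; simp_all))

theorem fiberProb_id (ω : Ω) : fiberProb μ id ω = μ.real {ω} := by simp [fiberProb]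

/-- A fibre is at least as likely as any of its atoms, so the terms are dominated by those of `id`.
Indexing by atoms puts the entropies of all variables over the same index set, where they can be
compared termwise. -/
theorem summable_entropy_terms [IsProbabilityMeasure μ] (hμ : HasFiniteEntropy μ (id : Ω → Ω))
    {S : Type*} (X : Ω → S) :
    Summable fun ω => μ.real {ω} * -Real.log (fiberProb μ X ω) := by
  refine Summable.of_nonneg_of_le (fun ω => ?_) (fun ω => ?_) hμ
  · exact mul_nonneg measureReal_nonneg
      (neg_nonneg.2 (Real.log_nonpos (fiberProb_nonneg X ω) (fiberProb_le_one X ω)))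
  · rcases (measureReal_nonneg (μ := μ) (s := {ω})).eq_or_lt with h | h
    · simp [← h]
    · have h1 : μ.real {ω} ≤ fiberProb μ X ω := by
        rw [← fiberProb_id]; exact fiberProb_mono (by simp +contextual) ω
      have := Real.log_le_log h h1
      simp only [Set.preimage_id, Real.negMulLog]
      nlinarith

variable [DiscreteMeasurableSpace Ω] [Countable Ω]

theorem measure_fiber_eq_tsum {S : Type*} (X : Ω → S) (ω : Ω) :
    μ (X ⁻¹' {X ω}) = ∑' ω', (X ⁻¹' {X ω}).indicator (fun ω' => μ {ω'}) ω' :=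
  (Measure.tsum_indicator_apply_singleton μ _ (Set.to_countable _).measurableSet).symm

/-- The summands are conditional probabilities inside a single fibre of `X`. The bound is an
inequality because a null fibre contributes 0. -/
theorem tsum_div_fiber_le_one {S : Type*} (X : Ω → S) (E : Set Ω)
    (hE : ∀ ω ∈ E, ∀ ω' ∈ E, X ω = X ω') :
    ∑' ω, E.indicator (fun ω => μ {ω} * (μ (X ⁻¹' {X ω}))⁻¹) ω ≤ 1 := by
  rcases E.eq_empty_or_nonempty with rfl | ⟨ω₀, h₀⟩
  · simp
  calc ∑' ω, E.indicator (fun ω => μ {ω} * (μ (X ⁻¹' {X ω}))⁻¹) ω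
      ≤ ∑' ω, (X ⁻¹' {X ω₀}).indicator (fun ω => μ {ω}) ω * (μ (X ⁻¹' {X ω₀}))⁻¹ := by
        refine ENNReal.tsum_le_tsum (fun ω => ?_)
        by_cases h : ω ∈ E
        · simp [h, hE ω h ω₀ h₀]
        · simp [h]
    _ = μ (X ⁻¹' {X ω₀}) * (μ (X ⁻¹' {X ω₀}))⁻¹ := by
        rw [ENNReal.tsum_mul_right, ← measure_fiber_eq_tsum]
    _ ≤ 1 := ENNReal.mul_inv_le_one _

variable [IsProbabilityMeasure μ]

theorem hasSum_measureReal_singleton : HasSum (fun ω => μ.real {ω}) 1 := by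
  have h : ∑' ω, μ {ω} = 1 := by
    rw [← measure_univ (μ := μ), ← Measure.tsum_indicator_apply_singleton μ Set.univ .univ]
    simp
  have h2 := ENNReal.hasSum_toReal (f := fun ω => μ {ω}) (by simp [h])
  rw [← ENNReal.tsum_toReal_eq (by simp), h] at h2
  simpa [Measure.real] using h2

theorem hasSum_measureReal_fiber (E : Set Ω) :
    HasSum (fun ω : E => μ.real {(ω : Ω)}) (μ.real E) := by
  have h : ∑' ω : E, μ {(ω : Ω)} = μ E := by
    rw [← Measure.tsum_indicator_apply_singleton μ E E.to_countable.measurableSet]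
    exact tsum_subtype E (fun ω => μ {ω})
  have h2 := ENNReal.hasSum_toReal (f := fun ω : E => μ {(ω : Ω)}) (by simp [h])
  rw [← ENNReal.tsum_toReal_eq (by simp), h] at h2
  simpa [Measure.real] using h2

theorem hasSum_fiber_entropy_terms {S : Type*} (X : Ω → S) (s : S) :
    HasSum (fun ω : {ω // X ω = s} => μ.real {ω.1} * -Real.log (fiberProb μ X ω.1))
      (Real.negMulLog (μ.real (X ⁻¹' {s}))) := by
  have h1 := (hasSum_measureReal_fiber (μ := μ) (X ⁻¹' {s})).mul_right
    (-Real.log (μ.real (X ⁻¹' {s})))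
  rw [Real.negMulLog, neg_mul_comm]
  refine h1.congr_fun fun ω => ?_
  have : X ω.1 = s := ω.2
  simp [fiberProb, this]

theorem hasSum_entropy (hμ : HasFiniteEntropy μ (id : Ω → Ω)) {S : Type*} (X : Ω → S) :
    HasSum (fun ω => μ.real {ω} * -Real.log (fiberProb μ X ω)) (entropy μ X) := by
  have hs := summable_entropy_terms hμ X
  refine hs.hasSum_iff.2 ?_
  rw [← (Equiv.sigmaFiberEquiv X).tsum_eq]
  refine (Summable.tsum_sigma ((Equiv.sigmaFiberEquiv X).summable_iff.2 hs)).trans ?_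
  exact tsum_congr fun s => (hasSum_fiber_entropy_terms X s).tsum_eq

theorem summable_measureReal_fiber {S : Type*} (X : Ω → S) :
    Summable fun s => μ.real (X ⁻¹' {s}) := by
  have h := (Equiv.sigmaFiberEquiv X).summable_iff.2 (hasSum_measureReal_singleton (μ := μ)).summable
  exact ((summable_sigma_of_nonneg fun _ => measureReal_nonneg).1 h).2.congr fun s =>
    (hasSum_measureReal_fiber (μ := μ) (X ⁻¹' {s})).tsum_eq

theorem HasFiniteEntropy.summable {S : Type*} {X : Ω → S} (hX : HasFiniteEntropy μ X) :
    Summable fun ω => μ.real {ω} * -Real.log (fiberProb μ X ω) := by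
  refine (Equiv.sigmaFiberEquiv X).summable_iff.1 ((summable_sigma_of_nonneg fun z => ?_).2
    ⟨fun s => (hasSum_fiber_entropy_terms X s).summable, hX.congr fun s =>
      (hasSum_fiber_entropy_terms X s).tsum_eq.symm⟩)
  exact mul_nonneg measureReal_nonneg
    (neg_nonneg.2 (Real.log_nonpos (fiberProb_nonneg X _) (fiberProb_le_one X _)))

theorem entropy_congr {S T : Type*} (hμ : HasFiniteEntropy μ (id : Ω → Ω)) {X : Ω → S} {Y : Ω → T}
    (h : ∀ ω ω', X ω = X ω' ↔ Y ω = Y ω') : entropy μ X = entropy μ Y := by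
  refine (hasSum_entropy hμ X).unique ?_
  convert hasSum_entropy hμ Y using 5 with ω
  exact le_antisymm (fiberProb_mono (fun a b => (h a b).1) _)
    (fiberProb_mono (fun a b => (h a b).2) _)

/-- The `χ²`-type sum behind submodularity: the average of the ratio of the conditionally
independent law to the joint law is at most one. -/
theorem tsum_ratio_le_one {S T U : Type*} (P : Ω → S) (Q : Ω → T) (R : Ω → U)
    (hP : ∀ ω ω', P ω = P ω' → R ω = R ω') (hQ : ∀ ω ω', Q ω = Q ω' → R ω = R ω') :
    ∑' ω, μ {ω} * (μ ((fun ω => (P ω, Q ω)) ⁻¹' {(P ω, Q ω)}))⁻¹ * (μ (R ⁻¹' {R ω}))⁻¹ *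
      μ (P ⁻¹' {P ω}) * μ (Q ⁻¹' {Q ω}) ≤ 1 := by
  set J : Ω → S × T := fun ω => (P ω, Q ω) with hJ
  -- The masses of the two fibres become sums over `ω₁` and `ω₂`. Summing over `ω` first then leaves
  -- conditional probabilities within one fibre of `J`.
  have expand : ∀ ω, μ {ω} * (μ (J ⁻¹' {J ω}))⁻¹ * (μ (R ⁻¹' {R ω}))⁻¹ *
      μ (P ⁻¹' {P ω}) * μ (Q ⁻¹' {Q ω}) =
      ∑' ω₁, ∑' ω₂, (P ⁻¹' {P ω}).indicator (fun ω' => μ {ω'}) ω₁ *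
        (Q ⁻¹' {Q ω}).indicator (fun ω' => μ {ω'}) ω₂ *
        (μ {ω} * (μ (J ⁻¹' {J ω}))⁻¹ * (μ (R ⁻¹' {R ω}))⁻¹) := by
    intro ω
    simp_rw [ENNReal.tsum_mul_right, ENNReal.tsum_mul_left, ENNReal.tsum_mul_right]
    rw [← measure_fiber_eq_tsum, ← measure_fiber_eq_tsum]
    ring
  calc _ = ∑' ω, ∑' ω₁, ∑' ω₂, (P ⁻¹' {P ω}).indicator (fun ω' => μ {ω'}) ω₁ *
        (Q ⁻¹' {Q ω}).indicator (fun ω' => μ {ω'}) ω₂ *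
        (μ {ω} * (μ (J ⁻¹' {J ω}))⁻¹ * (μ (R ⁻¹' {R ω}))⁻¹) := tsum_congr expand
    _ = ∑' ω₁, ∑' ω₂, ∑' ω, (P ⁻¹' {P ω}).indicator (fun ω' => μ {ω'}) ω₁ *
        (Q ⁻¹' {Q ω}).indicator (fun ω' => μ {ω'}) ω₂ *
        (μ {ω} * (μ (J ⁻¹' {J ω}))⁻¹ * (μ (R ⁻¹' {R ω}))⁻¹) := by
      rw [ENNReal.tsum_comm]
      exact tsum_congr fun ω₁ => ENNReal.tsum_comm
    _ ≤ ∑' ω₁, ∑' ω₂, μ {ω₁} * (μ (R ⁻¹' {R ω₁}))⁻¹ *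
        (R ⁻¹' {R ω₁}).indicator (fun ω' => μ {ω'}) ω₂ := by
      refine ENNReal.tsum_le_tsum fun ω₁ => ENNReal.tsum_le_tsum fun ω₂ => ?_
      calc _ ≤ ∑' ω, μ {ω₁} * (μ (R ⁻¹' {R ω₁}))⁻¹ *
            (R ⁻¹' {R ω₁}).indicator (fun ω' => μ {ω'}) ω₂ *
            {ω | P ω = P ω₁ ∧ Q ω = Q ω₂}.indicator
              (fun ω => μ {ω} * (μ (J ⁻¹' {J ω}))⁻¹) ω := by
            refine ENNReal.tsum_le_tsum fun ω => ?_
            by_cases h1 : P ω = P ω₁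
            · by_cases h2 : Q ω = Q ω₂
              · have h3 : R ω = R ω₁ := hP _ _ h1
                have h4 : R ω₂ = R ω₁ := (hQ _ _ h2).symm.trans h3
                have h5 : ω ∈ {ω | P ω = P ω₁ ∧ Q ω = Q ω₂} := ⟨h1, h2⟩
                rw [Set.indicator_of_mem h5,
                  Set.indicator_of_mem (show ω₁ ∈ P ⁻¹' {P ω} from h1.symm),
                  Set.indicator_of_mem (show ω₂ ∈ Q ⁻¹' {Q ω} from h2.symm),
                  Set.indicator_of_mem (show ω₂ ∈ R ⁻¹' {R ω₁} from h4), h3]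
                refine le_of_eq (by ring)
              · rw [Set.indicator_of_notMem (show ω₂ ∉ Q ⁻¹' {Q ω} from fun h => h2 h.symm)]
                simp
            · rw [Set.indicator_of_notMem (show ω₁ ∉ P ⁻¹' {P ω} from fun h => h1 h.symm)]
              simp
        _ ≤ _ := by
            rw [ENNReal.tsum_mul_left]
            refine mul_le_of_le_one_right' (tsum_div_fiber_le_one J _ ?_)
            rintro ω ⟨h1, h2⟩ ω' ⟨h3, h4⟩
            simp [hJ, h1, h2, h3, h4]
    _ = ∑' ω₁, μ {ω₁} * ((μ (R ⁻¹' {R ω₁}))⁻¹ * μ (R ⁻¹' {R ω₁})) := by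
      refine tsum_congr fun ω₁ => ?_
      rw [ENNReal.tsum_mul_left, ← measure_fiber_eq_tsum, mul_assoc]
    _ ≤ ∑' ω₁, μ {ω₁} := by
      refine ENNReal.tsum_le_tsum fun ω₁ => mul_le_of_le_one_right' ?_
      exact ENNReal.inv_mul_le_one _
    _ = 1 := by
      rw [← measure_univ (μ := μ), ← Measure.tsum_indicator_apply_singleton μ Set.univ .univ]
      simp

/-- Submodularity of entropy. -/
theorem entropy_add_le {S T U V : Type*} (hμ : HasFiniteEntropy μ (id : Ω → Ω)) (P : Ω → S) (Q : Ω → T)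
    (J : Ω → V) (R : Ω → U) (hP : ∀ ω ω', P ω = P ω' → R ω = R ω') (hQ : ∀ ω ω', Q ω = Q ω' → R ω = R ω')
    (hJ : ∀ ω ω', P ω = P ω' → Q ω = Q ω' → J ω = J ω') :
    entropy μ J + entropy μ R ≤ entropy μ P + entropy μ Q := by
  set PQ : Ω → S × T := fun ω => (P ω, Q ω) with hPQ
  set r : Ω → ℝ := fun ω => μ.real {ω} * (fiberProb μ PQ ω)⁻¹ * (fiberProb μ R ω)⁻¹ *
    fiberProb μ P ω * fiberProb μ Q ω with hr
  have hr0 : ∀ ω, 0 ≤ r ω := fun ω => by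
    have := fiberProb_nonneg (μ := μ) PQ ω
    have := fiberProb_nonneg (μ := μ) R ω
    have := fiberProb_nonneg (μ := μ) P ω
    have := fiberProb_nonneg (μ := μ) Q ω
    have : 0 ≤ μ.real {ω} := measureReal_nonneg
    positivity
  have hrle : ∑' ω, ENNReal.ofReal (r ω) ≤ 1 := by
    refine le_trans (ENNReal.tsum_le_tsum fun ω => ?_) (tsum_ratio_le_one P Q R hP hQ (μ := μ))
    rcases (measureReal_nonneg (μ := μ) (s := {ω})).eq_or_lt with h | h
    · simp [hr, ← h]
    · have h1 := fiberProb_pos PQ h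
      have h2 := fiberProb_pos R h
      have h3 := fiberProb_pos P h
      have h4 := fiberProb_pos Q h
      rw [hr]
      simp only
      rw [ENNReal.ofReal_mul (by positivity), ENNReal.ofReal_mul (by positivity),
        ENNReal.ofReal_mul (by positivity), ENNReal.ofReal_mul (by positivity),
        ENNReal.ofReal_inv_of_pos h1, ENNReal.ofReal_inv_of_pos h2]
      simp [fiberProb, hPQ]
  have hsum : ∀ F : Finset Ω, ∑ ω ∈ F, r ω ≤ 1 := fun F => by
    rw [← ENNReal.ofReal_le_one, ENNReal.ofReal_sum_of_nonneg (fun ω _ => hr0 ω)]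
    exact (ENNReal.sum_le_tsum F).trans hrle
  have hrs : Summable r := summable_of_sum_le hr0 hsum
  have hr1 : ∑' ω, r ω ≤ 1 := hrs.tsum_le_of_sum_le hsum
  -- Termwise, log x ≤ x - 1 at the ratio of the conditionally independent law to the joint law; the
  -- right-hand side sums to at most 1 - 1 = 0.
  have key := hasSum_le (fun ω => ?_)
    (((hasSum_entropy hμ J).add (hasSum_entropy hμ R)).sub
      ((hasSum_entropy hμ P).add (hasSum_entropy hμ Q)))
    (hrs.hasSum.sub (hasSum_measureReal_singleton (μ := μ)))
  · linarith
  · rcases (measureReal_nonneg (μ := μ) (s := {ω})).eq_or_lt with h | h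
    · simp [hr, ← h]
    · have h1 := fiberProb_pos PQ h
      have h2 := fiberProb_pos R h
      have h3 := fiberProb_pos P h
      have h4 := fiberProb_pos Q h
      have h5 : fiberProb μ PQ ω ≤ fiberProb μ J ω :=
        fiberProb_mono (fun a b hab => by
          simp only [hPQ, Prod.mk.injEq] at hab; exact hJ a b hab.1 hab.2) ω
      have h6 := Real.log_le_log h1 h5
      have h7 := Real.log_le_sub_one_of_pos (x := (fiberProb μ PQ ω)⁻¹ * (fiberProb μ R ω)⁻¹ *
        fiberProb μ P ω * fiberProb μ Q ω) (by positivity)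
      rw [Real.log_mul (by positivity) (by positivity),
        Real.log_mul (by positivity) (by positivity),
        Real.log_mul (by positivity) (by positivity), Real.log_inv, Real.log_inv] at h7
      have h8 := mul_le_mul_of_nonneg_left (h7.trans' (by linarith :
        -Real.log (fiberProb μ J ω) - Real.log (fiberProb μ R ω) + Real.log (fiberProb μ P ω)
          + Real.log (fiberProb μ Q ω) ≤ _)) h.le
      simp only [hr]
      linarith

end Calculus

/-! ### Entropic quantities depend only on the joint law. -/

section Transfer

variable {Ω Ω' S T U V : Type*} [MeasurableSpace Ω] [MeasurableSpace Ω']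

theorem hasFiniteEntropy_map [MeasurableSpace S] [DiscreteMeasurableSpace S] {μ : Measure Ω}
    {Z : Ω → S} (hZ : Measurable Z) {f : S → T} :
    HasFiniteEntropy (μ.map Z) f ↔ HasFiniteEntropy μ (fun ω => f (Z ω)) := by
  unfold HasFiniteEntropy
  refine summable_congr fun x => ?_
  rw [map_measureReal_apply hZ (.of_discrete)]
  rfl

theorem entropy_map [MeasurableSpace S] [DiscreteMeasurableSpace S] {μ : Measure Ω}
    {Z : Ω → S} (hZ : Measurable Z) (f : S → T) :
    entropy (μ.map Z) f = entropy μ (fun ω => f (Z ω)) := by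
  unfold entropy
  refine tsum_congr fun x => ?_
  rw [map_measureReal_apply hZ (.of_discrete)]
  rfl

theorem mutualInfo_map [MeasurableSpace S] [DiscreteMeasurableSpace S] {μ : Measure Ω}
    {Z : Ω → S} (hZ : Measurable Z) (f : S → T) (g : S → U) :
    mutualInfo (μ.map Z) f g = mutualInfo μ (fun ω => f (Z ω)) (fun ω => g (Z ω)) := by
  simp only [mutualInfo, condEntropy, entropy_map hZ]

theorem condMutualInfo_map [MeasurableSpace S] [DiscreteMeasurableSpace S] {μ : Measure Ω}
    {Z : Ω → S} (hZ : Measurable Z) (f : S → T) (g : S → U) (h : S → V) :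
    condMutualInfo (μ.map Z) f g h =
      condMutualInfo μ (fun ω => f (Z ω)) (fun ω => g (Z ω)) (fun ω => h (Z ω)) := by
  simp only [condMutualInfo, condEntropy, entropy_map hZ]

end Transfer

/-! ### Finite entropy of a pair. -/

section Product

variable {S T : Type*} [MeasurableSpace S] [DiscreteMeasurableSpace S] [Countable S]
  [MeasurableSpace T] [DiscreteMeasurableSpace T] [Countable T]

/-- Subadditivity through `entropy_add_le` would presuppose the conclusion. Instead log x ≤ x - 1,
at the ratio of the product of the marginals to the joint law, dominates each term by those of the
two marginal entropies plus a product of marginal masses. -/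
theorem hasFiniteEntropy_prod {μ : Measure (S × T)} [IsProbabilityMeasure μ]
    (h₁ : HasFiniteEntropy μ Prod.fst) (h₂ : HasFiniteEntropy μ Prod.snd) :
    HasFiniteEntropy μ (id : S × T → S × T) := by
  have hS : Summable fun z : S × T =>
      μ.real (Prod.fst ⁻¹' {z.1}) * μ.real (Prod.snd ⁻¹' {z.2}) :=
    (summable_measureReal_fiber (Prod.fst : S × T → S)).mul_of_nonneg
      (summable_measureReal_fiber (Prod.snd : S × T → T))
      (fun _ => measureReal_nonneg) (fun _ => measureReal_nonneg)
  refine Summable.of_nonneg_of_le (fun z => Real.negMulLog_nonneg measureReal_nonneg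
    measureReal_le_one) (fun z => ?_) ((h₁.summable.add h₂.summable).add hS)
  simp only [Set.preimage_id]
  rcases (measureReal_nonneg (μ := μ) (s := {z})).eq_or_lt with h | h
  · simp only [← h, Real.negMulLog_zero, zero_mul, zero_add]
    positivity
  · have q1 := fiberProb_pos (Prod.fst : S × T → S) h
    have q2 := fiberProb_pos (Prod.snd : S × T → T) h
    have h7 := Real.log_le_sub_one_of_pos (x := (μ.real {z})⁻¹ * fiberProb μ Prod.fst z *
        fiberProb μ Prod.snd z) (by positivity)
    rw [Real.log_mul (by positivity) (by positivity),
        Real.log_mul (by positivity) (by positivity), Real.log_inv] at h7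
    have h8 := mul_le_mul_of_nonneg_left h7 h.le
    have h9 : μ.real {z} * ((μ.real {z})⁻¹ * fiberProb μ Prod.fst z *
        fiberProb μ Prod.snd z) = fiberProb μ Prod.fst z * fiberProb μ Prod.snd z := by
      field_simp
    have h10 : fiberProb μ Prod.fst z * fiberProb μ Prod.snd z =
      μ.real (Prod.fst ⁻¹' {z.1}) * μ.real (Prod.snd ⁻¹' {z.2}) := rfl
    rw [← h10, Real.negMulLog]
    linarith

end Product

/-! ### Conditionally independent gluing of laws. -/

section Coupling

variable {W V T : Type*} [MeasurableSpace W] [DiscreteMeasurableSpace W] [Countable W]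
  [MeasurableSpace V] [DiscreteMeasurableSpace V] [Countable V]
  [MeasurableSpace T] [DiscreteMeasurableSpace T] [Countable T]

/-- Two laws with a common marginal can be glued so that the outer variables are conditionally
independent given the shared one. -/
theorem exists_condIndep_coupling (ρ : Measure (W × V)) (ν : Measure (V × T))
    [IsProbabilityMeasure ρ] [IsProbabilityMeasure ν] (h : ρ.snd = ν.fst) :
    ∃ π : Measure (W × V × T), IsProbabilityMeasure π ∧
      π.map (fun z => (z.1, z.2.1)) = ρ ∧ π.snd = ν ∧
      ∀ z : W × V × T, π.real {z} * ν.fst.real {z.2.1} =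
        ρ.real {(z.1, z.2.1)} * ν.real {z.2} := by
  have : Nonempty T := (nonempty_of_isProbabilityMeasure ν).map Prod.snd
  -- The kernel ignores the `W` coordinate, which is what makes the outer variables conditionally
  -- independent.
  set κ := ν.condKernel.comap (Prod.snd : W × V → V) measurable_snd with hκ
  have m : Measurable (fun p : (W × V) × T => (p.1.1, p.1.2, p.2)) := .of_discrete
  have hd : ν.fst.compProd ν.condKernel = ν := ν.disintegrate ν.condKernel
  refine ⟨(ρ.compProd κ).map (fun p => (p.1.1, p.1.2, p.2)),
    Measure.isProbabilityMeasure_map m.aemeasurable, ?_, ?_, ?_⟩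
  · rw [Measure.map_map .of_discrete m]
    exact Measure.fst_compProd ρ κ
  · rw [Measure.snd, Measure.map_map .of_discrete m]
    conv_rhs => rw [← hd]
    ext E hE
    rw [Measure.map_apply .of_discrete hE, Measure.compProd_apply .of_discrete,
      Measure.compProd_apply hE, ← h, Measure.snd, lintegral_map .of_discrete .of_discrete]
    rfl
  · rintro ⟨w, v, t⟩
    have e1 : ((ρ.compProd κ).map (fun p => (p.1.1, p.1.2, p.2))) {(w, v, t)} =
        ρ {(w, v)} * ν.condKernel v {t} := by
      rw [Measure.map_apply m .of_discrete]
      have : (fun p : (W × V) × T => (p.1.1, p.1.2, p.2)) ⁻¹' {(w, v, t)} = {(w, v)} ×ˢ {t} := by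
        ext ⟨⟨a, b⟩, c⟩; simp; tauto
      rw [this, Measure.compProd_apply_prod .of_discrete .of_discrete]
      simp [hκ]
    have e2 : ν {(v, t)} = ν.fst {v} * ν.condKernel v {t} := by
      conv_lhs => rw [← hd, ← Set.singleton_prod_singleton,
        Measure.compProd_apply_prod .of_discrete .of_discrete]
      simp
    simp only [Measure.real, e1, e2, ENNReal.toReal_mul]
    ring

end Coupling

/-! ### Comparison of quantities on different spaces through a common law. -/

section Transfer

variable {Ω Ω' S T U V : Type*} [MeasurableSpace Ω] [MeasurableSpace Ω']
  [MeasurableSpace S] [DiscreteMeasurableSpace S] {μ : Measure Ω} {μ' : Measure Ω'}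
  {Z : Ω → S} {Z' : Ω' → S}

theorem hasFiniteEntropy_of_map_eq (h : μ.map Z = μ'.map Z') (hZ : Measurable Z)
    (hZ' : Measurable Z') (f : S → T) (hf : HasFiniteEntropy μ' fun ω => f (Z' ω)) :
    HasFiniteEntropy μ fun ω => f (Z ω) := by
  rwa [← hasFiniteEntropy_map hZ, h, hasFiniteEntropy_map hZ']

theorem mutualInfo_eq_of_map_eq (h : μ.map Z = μ'.map Z') (hZ : Measurable Z)
    (hZ' : Measurable Z') (f : S → T) (g : S → U) :
    mutualInfo μ (fun ω => f (Z ω)) (fun ω => g (Z ω)) =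
      mutualInfo μ' (fun ω => f (Z' ω)) (fun ω => g (Z' ω)) := by
  rw [← mutualInfo_map hZ, h, mutualInfo_map hZ']

theorem condMutualInfo_eq_of_map_eq (h : μ.map Z = μ'.map Z') (hZ : Measurable Z)
    (hZ' : Measurable Z') (f : S → T) (g : S → U) (k : S → V) :
    condMutualInfo μ (fun ω => f (Z ω)) (fun ω => g (Z ω)) (fun ω => k (Z ω)) =
      condMutualInfo μ' (fun ω => f (Z' ω)) (fun ω => g (Z' ω)) (fun ω => k (Z' ω)) := by
  rw [← condMutualInfo_map hZ, h, condMutualInfo_map hZ']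

end Transfer

/-! ### Shannon-type inequalities and the Ingleton-type inequality. -/

section Shannon

variable {Ω : Type*} [MeasurableSpace Ω] [DiscreteMeasurableSpace Ω] [Countable Ω]
  {μ : Measure Ω} [IsProbabilityMeasure μ]

theorem HasFiniteEntropy.of_id (hμ : HasFiniteEntropy μ (id : Ω → Ω)) {S : Type*} (X : Ω → S) :
    HasFiniteEntropy μ X :=
  (((summable_sigma_of_nonneg fun _ => mul_nonneg measureReal_nonneg
    (neg_nonneg.2 (Real.log_nonpos (fiberProb_nonneg X _) (fiberProb_le_one X _)))).1
    ((Equiv.sigmaFiberEquiv X).summable_iff.2 (summable_entropy_terms hμ X))).2).congr fun s =>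
      (hasSum_fiber_entropy_terms X s).tsum_eq

theorem condMutualInfo_eq_zero {S T V : Type*} (hμ : HasFiniteEntropy μ (id : Ω → Ω))
    {X : Ω → S} {Y : Ω → T} {Z : Ω → V}
    (h : ∀ ω, 0 < μ.real {ω} →
      fiberProb μ (fun ω => (X ω, (Y ω, Z ω))) ω * fiberProb μ Z ω =
        fiberProb μ (fun ω => (X ω, Z ω)) ω * fiberProb μ (fun ω => (Y ω, Z ω)) ω) :
    condMutualInfo μ X Y Z = 0 := by
  have h1 := ((hasSum_entropy hμ (fun ω => (X ω, (Y ω, Z ω)))).add (hasSum_entropy hμ Z))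
  have h2 := ((hasSum_entropy hμ (fun ω => (X ω, Z ω))).add
    (hasSum_entropy hμ (fun ω => (Y ω, Z ω))))
  have h3 := h1.unique (h2.congr_fun fun ω => ?_)
  · simp only [condMutualInfo, condEntropy]
    linarith
  · rcases (measureReal_nonneg (μ := μ) (s := {ω})).eq_or_lt with h0 | h0
    · simp [← h0]
    · have h4 := congrArg Real.log (h ω h0)
      rw [Real.log_mul (fiberProb_pos _ h0).ne' (fiberProb_pos _ h0).ne',
        Real.log_mul (fiberProb_pos _ h0).ne' (fiberProb_pos _ h0).ne'] at h4
      linear_combination (-μ.real {ω}) * h4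

variable {SW SX SY SA SB : Type*} (W : Ω → SW) (X : Ω → SX) (Y : Ω → SY) (A : Ω → SA) (B : Ω → SB)

theorem condMutualInfo_nonneg (hμ : HasFiniteEntropy μ (id : Ω → Ω)) :
    0 ≤ condMutualInfo μ X Y A := by
  have := entropy_add_le hμ (fun ω => (X ω, A ω)) (fun ω => (Y ω, A ω))
    (fun ω => (X ω, (Y ω, A ω))) A (by grind) (by grind) (by grind)
  simp only [condMutualInfo, condEntropy]
  linarith

theorem mutualInfo_nonneg (hμ : HasFiniteEntropy μ (id : Ω → Ω)) : 0 ≤ mutualInfo μ X Y := by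
  have := entropy_add_le hμ X Y (fun ω => (X ω, Y ω)) (fun _ => ()) (by grind) (by grind) (by grind)
  have h0 : entropy μ (fun _ : Ω => ()) = 0 := by simp [entropy]
  simp only [mutualInfo, condEntropy]
  linarith

/-- Chain rule I(X:Y) + I(X:A|Y) = I(X:A) + I(X:Y|A), with I(X:A|Y) dropped. This settles the case ε
≥ 1. -/
theorem mutualInfo_le_add (hμ : HasFiniteEntropy μ (id : Ω → Ω)) :
    mutualInfo μ X Y ≤ mutualInfo μ X A + condMutualInfo μ X Y A := by
  have := entropy_add_le hμ (fun ω => (X ω, Y ω)) (fun ω => (Y ω, A ω))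
    (fun ω => (X ω, (Y ω, A ω))) Y (by grind) (by grind) (by grind)
  simp only [condMutualInfo, condEntropy, mutualInfo]
  linarith

/-- The same chain rule with I(X:Y) dropped. It bounds the initial memory of the chain. -/
theorem condMutualInfo_le_add (hμ : HasFiniteEntropy μ (id : Ω → Ω)) :
    condMutualInfo μ X A Y ≤ mutualInfo μ X A + condMutualInfo μ X Y A := by
  have h1 := mutualInfo_nonneg X Y hμ
  have := entropy_congr hμ (X := fun ω => (X ω, (Y ω, A ω))) (Y := fun ω => (X ω, (A ω, Y ω)))
    (by grind)
  have := entropy_congr hμ (X := fun ω => (Y ω, A ω)) (Y := fun ω => (A ω, Y ω)) (by grind)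
  simp only [condMutualInfo, condEntropy, mutualInfo] at *
  linarith

/-- One step of a chain that is Markov conditionally on `Y`: leakage about `Y`. -/
theorem condMutualInfo_step_le (hμ : HasFiniteEntropy μ (id : Ω → Ω))
    (h : condMutualInfo μ W A (fun ω => (X ω, Y ω)) = 0) :
    condMutualInfo μ W Y A ≤ condMutualInfo μ W Y X + condMutualInfo μ X Y A := by
  -- `h1` gives I(W:Y|A) ≤ I(X:Y|A) + I(W:Y|X,A). With the Markov hypothesis, `h2` gives I(W:Y|X,A)
  -- ≤ I(W:Y|X).
  have h1 := entropy_add_le hμ (fun ω => (W ω, X ω, A ω)) (fun ω => (W ω, (Y ω, A ω)))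
    (fun ω => (W ω, (A ω, (X ω, Y ω)))) (fun ω => (W ω, A ω)) (by grind) (by grind) (by grind)
  have h2 := entropy_add_le hμ (fun ω => (W ω, X ω)) (fun ω => (X ω, A ω))
    (fun ω => (W ω, X ω, A ω)) X (by grind) (by grind) (by grind)
  have e1 := entropy_congr hμ (X := fun ω => (W ω, (Y ω, X ω))) (Y := fun ω => (W ω, (X ω, Y ω)))
    (by grind)
  have e2 := entropy_congr hμ (X := fun ω => (Y ω, X ω)) (Y := fun ω => (X ω, Y ω)) (by grind)
  have e3 := entropy_congr hμ (X := fun ω => (X ω, (Y ω, A ω)))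
    (Y := fun ω => (A ω, (X ω, Y ω))) (by grind)
  simp only [condMutualInfo, condEntropy] at *
  linarith

/-- Conditional data processing inequality, shortening the chain at its end. -/
theorem condMutualInfo_le_of_markov (hμ : HasFiniteEntropy μ (id : Ω → Ω))
    (h : condMutualInfo μ W A (fun ω => (X ω, Y ω)) = 0) :
    condMutualInfo μ W A Y ≤ condMutualInfo μ W X Y := by
  have h1 := entropy_add_le hμ (fun ω => (W ω, (A ω, Y ω))) (fun ω => (A ω, (X ω, Y ω)))
    (fun ω => (W ω, (A ω, (X ω, Y ω)))) (fun ω => (A ω, Y ω)) (by grind) (by grind) (by grind)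
  simp only [condMutualInfo, condEntropy] at *
  linarith

/-- Conditional data processing inequality, shortening the chain at its start. -/
theorem condMutualInfo_le_of_markov' (hμ : HasFiniteEntropy μ (id : Ω → Ω))
    (h : condMutualInfo μ W A (fun ω => (X ω, Y ω)) = 0) :
    condMutualInfo μ W A Y ≤ condMutualInfo μ X A Y := by
  have h1 := entropy_add_le hμ (fun ω => (W ω, (A ω, Y ω))) (fun ω => (W ω, (X ω, Y ω)))
    (fun ω => (W ω, (A ω, (X ω, Y ω)))) (fun ω => (W ω, Y ω)) (by grind) (by grind) (by grind)
  have e3 := entropy_congr hμ (X := fun ω => (X ω, (A ω, Y ω)))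
    (Y := fun ω => (A ω, (X ω, Y ω))) (by grind)
  simp only [condMutualInfo, condEntropy] at *
  linarith

/-- The Ingleton-type inequality, with `W` in the role of the common information of `X` and `A`. -/
theorem mutualInfo_le_of_markov (hμ : HasFiniteEntropy μ (id : Ω → Ω))
    (h : condMutualInfo μ W (fun ω => (A ω, B ω)) (fun ω => (X ω, Y ω)) = 0) :
    mutualInfo μ W Y ≤ condMutualInfo μ X Y B + mutualInfo μ A B + condMutualInfo μ W Y X
      + condMutualInfo μ W Y A + condMutualInfo μ W X Y - condMutualInfo μ W A Y := by
  -- `h1` gives I(W:Y) ≤ I(W:B) + I(W:Y|B). By `h2`, `h3`, `h4` and the Markov hypothesis, I(W:Y|B)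
  -- ≤ I(X:Y|B) + I(W:Y|X,B) ≤ I(X:Y|B) + I(W:Y|X). By `h5` and `h6`, I(W:B) ≤ I(A:B) + I(W:B|A) ≤
  -- I(A:B) + I(W:Y|A) + I(W:B|A,Y). The last term is I(W:A,B|Y) - I(W:A|Y), and `h7` with the
  -- Markov hypothesis gives I(W:A,B|Y) ≤ I(W:X|Y).
  have h1 := entropy_add_le hμ (fun ω => (W ω, Y ω)) (fun ω => (Y ω, B ω))
    (fun ω => (W ω, Y ω, B ω)) Y (by grind) (by grind) (by grind)
  have h2 := entropy_add_le hμ (fun ω => (W ω, X ω, B ω)) (fun ω => (W ω, Y ω, B ω))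
    (fun ω => (W ω, X ω, Y ω, B ω)) (fun ω => (W ω, B ω)) (by grind) (by grind) (by grind)
  have h3 := entropy_add_le hμ (fun ω => (W ω, X ω)) (fun ω => (X ω, B ω))
    (fun ω => (W ω, X ω, B ω)) X (by grind) (by grind) (by grind)
  have h4 := entropy_add_le hμ (fun ω => (W ω, X ω, Y ω, B ω))
    (fun ω => ((A ω, B ω), (X ω, Y ω))) (fun ω => (W ω, ((A ω, B ω), (X ω, Y ω))))
    (fun ω => (X ω, Y ω, B ω)) (by grind) (by grind) (by grind)
  have h5 := entropy_add_le hμ (fun ω => (W ω, A ω)) (fun ω => (W ω, B ω))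
    (fun ω => (W ω, A ω, B ω)) W (by grind) (by grind) (by grind)
  have h6 := entropy_add_le hμ (fun ω => (W ω, A ω, B ω)) (fun ω => (Y ω, A ω, B ω))
    (fun ω => (W ω, Y ω, A ω, B ω)) (fun ω => (A ω, B ω)) (by grind) (by grind) (by grind)
  have h7 := entropy_add_le hμ (fun ω => (W ω, Y ω, A ω, B ω))
    (fun ω => ((A ω, B ω), (X ω, Y ω))) (fun ω => (W ω, ((A ω, B ω), (X ω, Y ω))))
    (fun ω => (Y ω, A ω, B ω)) (by grind) (by grind) (by grind)
  have h8 := entropy_add_le hμ (fun ω => (W ω, X ω, Y ω, A ω))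
    (fun ω => ((A ω, B ω), (X ω, Y ω))) (fun ω => (W ω, ((A ω, B ω), (X ω, Y ω))))
    (fun ω => (X ω, Y ω, A ω)) (by grind) (by grind) (by grind)
  have h9 := entropy_add_le hμ (fun ω => (W ω, X ω, Y ω)) (fun ω => (X ω, Y ω, A ω))
    (fun ω => (W ω, X ω, Y ω, A ω)) (fun ω => (X ω, Y ω)) (by grind) (by grind) (by grind)
  have e1 := entropy_congr hμ (X := fun ω => (W ω, (Y ω, X ω))) (Y := fun ω => (W ω, (X ω, Y ω)))
    (by grind)
  have e2 := entropy_congr hμ (X := fun ω => (Y ω, X ω)) (Y := fun ω => (X ω, Y ω)) (by grind)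
  have e3 := entropy_congr hμ (X := fun ω => (W ω, (Y ω, A ω))) (Y := fun ω => (W ω, (A ω, Y ω)))
    (by grind)
  have e4 := entropy_congr hμ (X := fun ω => (Y ω, A ω)) (Y := fun ω => (A ω, Y ω)) (by grind)
  simp only [condMutualInfo, condEntropy, mutualInfo] at *
  linarith

theorem condMutualInfo_eq_zero_of_prod (hμ : HasFiniteEntropy μ (id : Ω → Ω))
    (h : condMutualInfo μ W (fun ω => (A ω, B ω)) (fun ω => (X ω, Y ω)) = 0) :
    condMutualInfo μ W A (fun ω => (X ω, Y ω)) = 0 := by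
  refine le_antisymm ?_ (condMutualInfo_nonneg _ _ _ hμ)
  have h8 := entropy_add_le hμ (fun ω => (W ω, (A ω, (X ω, Y ω))))
    (fun ω => ((A ω, B ω), (X ω, Y ω))) (fun ω => (W ω, ((A ω, B ω), (X ω, Y ω))))
    (fun ω => (A ω, (X ω, Y ω))) (by grind) (by grind) (by grind)
  simp only [condMutualInfo, condEntropy] at *
  linarith

end Shannon

/-! ### Gluing with finite entropy. -/

section Coupling

variable {W V T : Type*} [MeasurableSpace W] [DiscreteMeasurableSpace W] [Countable W]
  [MeasurableSpace V] [DiscreteMeasurableSpace V] [Countable V]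
  [MeasurableSpace T] [DiscreteMeasurableSpace T] [Countable T]

/-- Gluing of finite-entropy laws along a common marginal, in terms of mutual information. -/
theorem exists_coupling_condMutualInfo_eq_zero (ρ : Measure (W × V)) (ν : Measure (V × T))
    (pρ : IsProbabilityMeasure ρ) (pν : IsProbabilityMeasure ν) (h : ρ.snd = ν.fst)
    (hρ : HasFiniteEntropy ρ (Prod.fst : W × V → W))
    (hν : HasFiniteEntropy ν (id : V × T → V × T)) :
    ∃ π : Measure (W × V × T), IsProbabilityMeasure π ∧
      HasFiniteEntropy π (id : W × V × T → W × V × T) ∧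
      π.map (fun z => (z.1, z.2.1)) = ρ ∧ π.map Prod.snd = ν ∧
      condMutualInfo π (fun z => z.1) (fun z => z.2.2) (fun z => z.2.1) = 0 := by
  obtain ⟨π, hπ, h1, h2, h3⟩ := exists_condIndep_coupling ρ ν h
  have h2' : π.map Prod.snd = ν := h2
  have hid : HasFiniteEntropy π (id : W × V × T → W × V × T) := by
    refine hasFiniteEntropy_prod ?_ ?_
    · rw [← h1, hasFiniteEntropy_map .of_discrete] at hρ
      exact hρ
    · rw [← h2', hasFiniteEntropy_map .of_discrete] at hν
      exact hν
  refine ⟨π, hπ, hid, h1, h2', condMutualInfo_eq_zero hid fun z _ => ?_⟩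
  have h4 := h3 z
  rw [← h2', ← h1, Measure.fst, map_measureReal_apply .of_discrete .of_discrete,
    map_measureReal_apply .of_discrete .of_discrete,
    map_measureReal_apply .of_discrete .of_discrete,
    map_measureReal_apply .of_discrete .of_discrete] at h4
  simp only [fiberProb]
  convert h4 using 3 <;> ext ⟨a, b, c⟩ <;> obtain ⟨a', b', c'⟩ := z <;> simp <;> tauto

end Coupling

/-! ### The resampling chain and its iteration. -/

section Step

variable {SX SY SA SB : Type*}
  [MeasurableSpace SX] [DiscreteMeasurableSpace SX] [Countable SX]
  [MeasurableSpace SY] [DiscreteMeasurableSpace SY] [Countable SY]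
  [MeasurableSpace SA] [DiscreteMeasurableSpace SA] [Countable SA]
  [MeasurableSpace SB] [DiscreteMeasurableSpace SB] [Countable SB]

/-- `ρ` is a law of triples `(X', X, Y)` in which `(X, Y)` and `(X', Y)` have law `σ`. -/
structure IsSelfCoupling (σ : Measure (SX × SY)) (ρ : Measure (SX × SX × SY)) : Prop where
  isProbabilityMeasure : IsProbabilityMeasure ρ
  map_snd : ρ.map Prod.snd = σ
  map_fst : ρ.map (fun z => (z.1, z.2.2)) = σ

/-- Two steps `X → A → X` of the chain that resamples conditionally on `Y`. -/
theorem IsSelfCoupling.exists_step {P : Measure (SX × SY × SA × SB)} [IsProbabilityMeasure P]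
    (hP : HasFiniteEntropy P (id : SX × SY × SA × SB → _)) {ρ : Measure (SX × SX × SY)}
    (hρ : IsSelfCoupling (P.map fun z => (z.1, z.2.1)) ρ) :
    ∃ ρ' : Measure (SX × SX × SY), IsSelfCoupling (P.map fun z => (z.1, z.2.1)) ρ' ∧
      condMutualInfo ρ' (·.1) (·.2.2) (·.2.1) ≤ condMutualInfo ρ (·.1) (·.2.2) (·.2.1)
        + condMutualInfo P (·.1) (·.2.1) (·.2.2.1) + condMutualInfo P (·.2.2.1) (·.2.1) (·.1) ∧
      condMutualInfo ρ' (·.1) (·.2.1) (·.2.2) ≤ condMutualInfo P (·.1) (·.2.2.1) (·.2.1) ∧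
      mutualInfo P (·.1) (·.2.1) ≤ condMutualInfo P (·.1) (·.2.1) (·.2.2.2)
        + mutualInfo P (·.2.2.1) (·.2.2.2) + 2 * condMutualInfo ρ (·.1) (·.2.2) (·.2.1)
        + condMutualInfo P (·.1) (·.2.1) (·.2.2.1)
        + condMutualInfo ρ (·.1) (·.2.1) (·.2.2) - condMutualInfo ρ' (·.1) (·.2.1) (·.2.2) := by
  obtain ⟨hρp, hρs, hρf⟩ := hρ
  have hX : HasFiniteEntropy ρ (Prod.fst : SX × SX × SY → SX) :=
    hasFiniteEntropy_of_map_eq hρf .of_discrete .of_discrete Prod.fst (hP.of_id _)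
  have m1 : Measurable fun z : SX × SY × SA × SB => ((z.1, z.2.1), (z.2.2.1, z.2.2.2)) :=
    .of_discrete
  have m2 : Measurable fun z : SX × SY × SA × SB => ((z.2.2.1, z.2.1), z.1) := .of_discrete
  have p1 := Measure.isProbabilityMeasure_map (μ := P) m1.aemeasurable
  have c1 : ρ.snd = (P.map fun z => ((z.1, z.2.1), (z.2.2.1, z.2.2.2))).fst := by
    rw [Measure.snd, hρs, Measure.fst, Measure.map_map measurable_fst m1]
    rfl
  have c2 : HasFiniteEntropy (P.map fun z => ((z.1, z.2.1), (z.2.2.1, z.2.2.2)))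
      (id : (SX × SY) × (SA × SB) → _) := (hasFiniteEntropy_map m1).2 (hP.of_id _)
  -- Move X → A: `π` is a law of (W, (X,Y), (A,B)). `B` is attached together with `A` because the
  -- Ingleton-type inequality needs both.
  obtain ⟨π, hπp, hπ, hπρ, hπs, hπi⟩ := exists_coupling_condMutualInfo_eq_zero ρ _ hρp p1 c1 hX c2
  have hπρ' : π.map (fun z => (z.1, z.2.1)) = ρ.map id := by rw [hπρ, Measure.map_id]
  have m3 : Measurable fun z : SX × (SX × SY) × (SA × SB) => (z.1, (z.2.2.1, z.2.1.2)) :=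
    .of_discrete
  have d1 : (π.map fun z => (z.1, (z.2.2.1, z.2.1.2))).snd =
      (P.map fun z => ((z.2.2.1, z.2.1), z.1)).fst := by
    rw [Measure.snd, Measure.fst, Measure.map_map measurable_snd m3,
      Measure.map_map measurable_fst m2]
    have := congrArg (Measure.map fun z : (SX × SY) × (SA × SB) => (z.2.1, z.1.2)) hπs
    rw [Measure.map_map .of_discrete measurable_snd,
      Measure.map_map .of_discrete m1] at this
    exact this
  have d2 : HasFiniteEntropy (P.map fun z => ((z.2.2.1, z.2.1), z.1))
      (id : (SA × SY) × SX → _) := (hasFiniteEntropy_map m2).2 (hP.of_id _)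
  have d3 : HasFiniteEntropy (π.map fun z => (z.1, (z.2.2.1, z.2.1.2)))
      (Prod.fst : SX × (SA × SY) → SX) := (hasFiniteEntropy_map m3).2 (hπ.of_id _)
  -- Move A → X: the old X and `B` are forgotten, and a fresh X is drawn given (A,Y).
  obtain ⟨π', hπp', hπ', hπρ₂, hπs', hπi'⟩ := exists_coupling_condMutualInfo_eq_zero _ _
    (Measure.isProbabilityMeasure_map m3.aemeasurable)
    (Measure.isProbabilityMeasure_map m2.aemeasurable) d1 d3 d2
  have m4 : Measurable fun z : SX × (SA × SY) × SX => (z.1, (z.2.2, z.2.1.2)) := .of_discrete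
  have i1 := condMutualInfo_eq_zero_of_prod (fun z : SX × (SX × SY) × (SA × SB) => z.1)
    (fun z => z.2.1.1) (fun z => z.2.1.2) (fun z => z.2.2.1) (fun z => z.2.2.2) hπ hπi
  have a1 := condMutualInfo_step_le _ _ _ _ hπ i1
  have a2 := condMutualInfo_le_of_markov' _ _ _ _ hπ i1
  have a3 := mutualInfo_le_of_markov (fun z : SX × (SX × SY) × (SA × SB) => z.1)
    (fun z => z.2.1.1) (fun z => z.2.1.2) (fun z => z.2.2.1) (fun z => z.2.2.2) hπ hπi
  have b1 := condMutualInfo_step_le (fun z : SX × (SA × SY) × SX => z.1) (fun z => z.2.1.1)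
    (fun z => z.2.1.2) (fun z => z.2.2) hπ' hπi'
  have b2 := condMutualInfo_le_of_markov (fun z : SX × (SA × SY) × SX => z.1) (fun z => z.2.1.1)
    (fun z => z.2.1.2) (fun z => z.2.2) hπ' hπi'
  -- transfer of the quantities on `π` to `P` and `ρ`
  have t1 := condMutualInfo_eq_of_map_eq hπs .of_discrete m1 (·.1.1) (·.1.2) (·.2.1)
  have t2 := condMutualInfo_eq_of_map_eq hπs .of_discrete m1 (·.1.1) (·.2.1) (·.1.2)
  have t3 := condMutualInfo_eq_of_map_eq hπs .of_discrete m1 (·.1.1) (·.1.2) (·.2.2)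
  have t4 := mutualInfo_eq_of_map_eq hπs .of_discrete m1 (·.2.1) (·.2.2)
  have t5 := condMutualInfo_eq_of_map_eq hπρ' .of_discrete .of_discrete (·.1) (·.2.2) (·.2.1)
  have t6 := condMutualInfo_eq_of_map_eq hπρ' .of_discrete .of_discrete (·.1) (·.2.1) (·.2.2)
  have t7 := mutualInfo_eq_of_map_eq hπρ' .of_discrete .of_discrete (·.1) (·.2.2)
  have t8 := mutualInfo_eq_of_map_eq hρf .of_discrete .of_discrete (·.1) (·.2)
  -- transfer of the quantities on `π'` to `π` and `P`
  have s1 := condMutualInfo_eq_of_map_eq hπρ₂ .of_discrete m3 (·.1) (·.2.2) (·.2.1)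
  have s2 := condMutualInfo_eq_of_map_eq hπρ₂ .of_discrete m3 (·.1) (·.2.1) (·.2.2)
  have s3 := condMutualInfo_eq_of_map_eq hπs' .of_discrete m2 (·.1.1) (·.1.2) (·.2)
  refine ⟨π'.map fun z => (z.1, (z.2.2, z.2.1.2)),
    ⟨Measure.isProbabilityMeasure_map m4.aemeasurable, ?_, ?_⟩, ?_⟩
  · have := congrArg (Measure.map fun z : (SA × SY) × SX => (z.2, z.1.2)) hπs'
    rw [Measure.map_map .of_discrete .of_discrete, Measure.map_map .of_discrete m2] at this
    rw [Measure.map_map .of_discrete m4]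
    exact this
  · have := congrArg (Measure.map fun z : SX × (SA × SY) => (z.1, z.2.2)) hπρ₂
    rw [Measure.map_map .of_discrete .of_discrete, Measure.map_map .of_discrete m3] at this
    have h' := congrArg (Measure.map fun z : SX × (SX × SY) => (z.1, z.2.2)) hπρ
    rw [Measure.map_map .of_discrete .of_discrete, hρf] at h'
    rw [Measure.map_map .of_discrete m4, ← h']
    exact this
  · rw [condMutualInfo_map m4, condMutualInfo_map m4]
    simp only [id] at *
    refine ⟨?_, ?_, ?_⟩ <;> linarith

/-- Iterating the chain `k` times gives a Matúš-type inequality. -/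
theorem mul_le_of_isSelfCoupling {P : Measure (SX × SY × SA × SB)} [IsProbabilityMeasure P]
    (hP : HasFiniteEntropy P (id : SX × SY × SA × SB → _)) (k : ℕ) {δ : ℝ}
    (h₁ : condMutualInfo P (·.1) (·.2.1) (·.2.2.1) ≤ δ)
    (h₂ : condMutualInfo P (·.2.2.1) (·.2.1) (·.1) ≤ δ) :
    k * (mutualInfo P (·.1) (·.2.1) - condMutualInfo P (·.1) (·.2.1) (·.2.2.2)
        - mutualInfo P (·.2.2.1) (·.2.2.2)) ≤
      condMutualInfo P (·.1) (·.2.2.1) (·.2.1) + (2 * k ^ 2 + 3 * k) * δ := by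
  -- Index k stands for k + 1 double moves. Passing from k to k + 1 costs twice the leakage plus one
  -- δ, that is (4k + 5)δ, which sums to (2k² + 3k)δ.
  have main : ∃ ρ : Measure (SX × SX × SY), IsSelfCoupling (P.map fun z => (z.1, z.2.1)) ρ ∧
      condMutualInfo ρ (·.1) (·.2.2) (·.2.1) ≤ 2 * (k + 1) * δ ∧
      condMutualInfo ρ (·.1) (·.2.1) (·.2.2) +
        k * (mutualInfo P (·.1) (·.2.1) - condMutualInfo P (·.1) (·.2.1) (·.2.2.2)
        - mutualInfo P (·.2.2.1) (·.2.2.2)) ≤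
      condMutualInfo P (·.1) (·.2.2.1) (·.2.1) + (2 * k ^ 2 + 3 * k) * δ := by
    induction k with
    | zero =>
      -- The diagonal coupling W = X has no leakage, but its memory is H(X|Y), which the hypotheses
      -- do not control. One double move brings the memory below I(X:A|Y).
      have m : Measurable fun z : SX × SY × SA × SB => (z.1, (z.1, z.2.1)) := .of_discrete
      have h0 : IsSelfCoupling (P.map fun z => (z.1, z.2.1)) (P.map fun z => (z.1, (z.1, z.2.1))) :=
        ⟨Measure.isProbabilityMeasure_map m.aemeasurable,
          by rw [Measure.map_map .of_discrete m]; rfl, by rw [Measure.map_map .of_discrete m]; rfl⟩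
      obtain ⟨ρ', h, q1, q2, -⟩ := h0.exists_step hP
      rw [condMutualInfo_map m] at q1
      have e1 := entropy_congr hP (X := fun z => (z.1, z.1)) (Y := fun z => z.1) (by grind)
      have e2 := entropy_congr hP (X := fun z => (z.1, (z.2.1, z.1)))
        (Y := fun z => (z.2.1, z.1)) (by grind)
      have e : condMutualInfo P (fun z => z.1) (fun z => z.2.1) (fun z => z.1) = 0 := by
        simp only [condMutualInfo, condEntropy] at *
        linarith
      refine ⟨ρ', h, ?_, ?_⟩
      · push_cast
        linarith
      · push_cast
        linarith
    | succ k ih =>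
      obtain ⟨ρ, h, q1, q2⟩ := ih
      obtain ⟨ρ', h', r1, r2, r3⟩ := h.exists_step hP
      refine ⟨ρ', h', ?_, ?_⟩
      · push_cast
        linarith
      · push_cast
        linarith
  obtain ⟨ρ, ⟨hp, hs, hf⟩, -, h⟩ := main
  have hX : HasFiniteEntropy ρ (id : SX × SX × SY → _) := hasFiniteEntropy_prod
    (hasFiniteEntropy_of_map_eq hf .of_discrete .of_discrete Prod.fst (hP.of_id _))
    (hasFiniteEntropy_of_map_eq hs .of_discrete .of_discrete id (hP.of_id _))
  have := condMutualInfo_nonneg (fun z : SX × SX × SY => z.1) (fun z => z.2.1) (fun z => z.2.2) hX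
  linarith

end Step

/-! ### Choice of the number of steps, and the final bounds. -/

theorem HasFiniteEntropy.prodMk {Ω S T : Type*} [MeasurableSpace Ω] {μ : Measure Ω}
    [IsProbabilityMeasure μ] [MeasurableSpace S] [DiscreteMeasurableSpace S] [Countable S]
    [MeasurableSpace T] [DiscreteMeasurableSpace T] [Countable T] {X : Ω → S} {Y : Ω → T}
    (hX : HasFiniteEntropy μ X) (hY : HasFiniteEntropy μ Y) (mX : Measurable X)
    (mY : Measurable Y) : HasFiniteEntropy μ fun ω => (X ω, Y ω) := by
  have m : Measurable fun ω => (X ω, Y ω) := mX.prodMk mY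
  have := Measure.isProbabilityMeasure_map (μ := μ) m.aemeasurable
  exact (hasFiniteEntropy_map m (f := id)).1 (hasFiniteEntropy_prod
    ((hasFiniteEntropy_map m).2 hX) ((hasFiniteEntropy_map m).2 hY))

/-- Optimising the number of steps in the Matúš-type inequality. -/
theorem le_sqrt_mul_of_forall_nat_mul_le {D I ε : ℝ} (hI : 0 ≤ I) (hε : 0 ≤ ε) (hε1 : ε ≤ 1)
    (h : ∀ k : ℕ, k * D ≤ (1 + ε) * I + (2 * k ^ 2 + 3 * k) * (ε * I)) : D ≤ 9 * √ε * I := by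
  obtain ⟨s, hs, rfl⟩ : ∃ s : ℝ, 0 ≤ s ∧ ε = s ^ 2 :=
    ⟨√ε, Real.sqrt_nonneg _, (Real.sq_sqrt hε).symm⟩
  rw [Real.sqrt_sq hs]
  have hs1 : s ≤ 1 := by nlinarith
  rcases hs.eq_or_lt with rfl | hs0
  -- For ε = 0 the hypothesis reads kD ≤ I for every k, so D ≤ 0 by the Archimedean property.
  · simp only [mul_zero, zero_mul]
    by_contra! hD
    obtain ⟨k, hk⟩ := exists_nat_gt (I / D)
    rw [div_lt_iff₀ hD] at hk
    have := h k
    norm_num at this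
    linarith
  · set k := ⌈1 / s⌉₊ with hk
    have k1 : 1 ≤ k * s := by
      have := Nat.le_ceil (1 / s)
      rwa [div_le_iff₀ hs0] at this
    have k2 : k * s ≤ 2 := by
      have := (Nat.ceil_lt_add_one (by positivity : 0 ≤ 1 / s)).le
      have h2 := mul_le_mul_of_nonneg_right this hs
      rw [add_mul, div_mul_cancel₀ _ hs0.ne'] at h2
      linarith
    have kpos : (0 : ℝ) < k := by
      by_contra! hk0
      nlinarith
    refine le_of_mul_le_mul_left ?_ kpos
    refine (h k).trans ?_
    -- With t = ks in [1, 2] and s ≤ 1, the terms 1, s², 2t² and 3ts are at most t, t, 4t and 3t;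
    -- hence the constant 9.
    have : (1 + s ^ 2) + (2 * k ^ 2 + 3 * k) * s ^ 2 ≤ 9 * (k * s) := by
      have e1 : (k * s) * (k * s) ≤ 2 * (k * s) := by gcongr
      have e2 : (k * s) * s ≤ (k * s) * 1 := by gcongr
      nlinarith
    have := mul_le_mul_of_nonneg_right this hI
    linarith

/-- The second inequality, for joint laws and `ε ≤ 1`. -/
theorem mutualInfo_le_of_law {SX SY SA SB : Type*}
    [MeasurableSpace SX] [DiscreteMeasurableSpace SX] [Countable SX]
    [MeasurableSpace SY] [DiscreteMeasurableSpace SY] [Countable SY]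
    [MeasurableSpace SA] [DiscreteMeasurableSpace SA] [Countable SA]
    [MeasurableSpace SB] [DiscreteMeasurableSpace SB] [Countable SB]
    {P : Measure (SX × SY × SA × SB)} [IsProbabilityMeasure P]
    (hP : HasFiniteEntropy P (id : SX × SY × SA × SB → _)) {ε : ℝ} (hε : 0 ≤ ε) (hε1 : ε ≤ 1)
    (h₁ : condMutualInfo P (·.1) (·.2.1) (·.2.2.1) ≤ ε * mutualInfo P (·.1) (·.2.2.1))
    (h₂ : condMutualInfo P (·.2.2.1) (·.2.1) (·.1) ≤ ε * mutualInfo P (·.1) (·.2.2.1)) :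
    mutualInfo P (·.1) (·.2.1) ≤ condMutualInfo P (·.1) (·.2.1) (·.2.2.2)
      + mutualInfo P (·.2.2.1) (·.2.2.2) + 9 * √ε * mutualInfo P (·.1) (·.2.2.1) := by
  have := le_sqrt_mul_of_forall_nat_mul_le (mutualInfo_nonneg _ _ hP) hε hε1 fun k =>
    (mul_le_of_isSelfCoupling hP k h₁ h₂).trans (add_le_add_left
      ((condMutualInfo_le_add _ _ _ hP).trans (by linarith)) _)
  linarith

end InfoIneq

theorem theorem2 :
    ∃ (C : ℝ) (K : ℝ → ℝ),
      ∀ {Ω SX SY SA SB : Type*} [MeasurableSpace Ω]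
        [MeasurableSpace SX] [MeasurableSingletonClass SX] [Countable SX]
        [MeasurableSpace SY] [MeasurableSingletonClass SY] [Countable SY]
        [MeasurableSpace SA] [MeasurableSingletonClass SA] [Countable SA]
        [MeasurableSpace SB] [MeasurableSingletonClass SB] [Countable SB]
        (μ : Measure Ω) [IsProbabilityMeasure μ]
        (X : Ω → SX) (Y : Ω → SY) (A : Ω → SA) (B : Ω → SB),
        Measurable X → Measurable Y → Measurable A → Measurable B →
        InfoIneq.HasFiniteEntropy μ X → InfoIneq.HasFiniteEntropy μ Y →
        InfoIneq.HasFiniteEntropy μ A → InfoIneq.HasFiniteEntropy μ B →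
        ∀ ε : ℝ, 0 ≤ ε →
          max (InfoIneq.condMutualInfo μ X Y A) (InfoIneq.condMutualInfo μ A Y X)
            ≤ ε * InfoIneq.mutualInfo μ X A →
          InfoIneq.mutualInfo μ X Y
              ≤ InfoIneq.condMutualInfo μ X Y A + InfoIneq.condMutualInfo μ X Y B
                + InfoIneq.mutualInfo μ A B + C * √ε * InfoIneq.mutualInfo μ X A
            ∧ ∀ M : ℝ, ε ≤ M →
                InfoIneq.mutualInfo μ X Y
                  ≤ InfoIneq.condMutualInfo μ X Y B + InfoIneq.mutualInfo μ A B
                    + K M * √ε * InfoIneq.mutualInfo μ X A := by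
  -- The 9 comes from the case ε ≤ 1. The extra |M| absorbs I(X:Y|A) ≤ ε·I(X:A) when 1 ≤ ε ≤ M.
  refine ⟨9, fun M => 9 + |M|, ?_⟩
  intro Ω SX SY SA SB _ _ _ _ _ _ _ _ _ _ _ _ _ μ _ X Y A B mX mY mA mB hX hY hA hB ε hε h
  have mAB := mA.prodMk mB
  have mYAB := mY.prodMk mAB
  have mZ : Measurable fun ω => (X ω, Y ω, A ω, B ω) := mX.prodMk mYAB
  have hP : InfoIneq.HasFiniteEntropy (μ.map fun ω => (X ω, Y ω, A ω, B ω)) id :=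
    (InfoIneq.hasFiniteEntropy_map mZ).2
      (hX.prodMk (hY.prodMk (hA.prodMk hB mA mB) mY mAB) mX mYAB)
  have := Measure.isProbabilityMeasure_map (μ := μ) mZ.aemeasurable
  have n1 := InfoIneq.condMutualInfo_nonneg (·.1) (·.2.1) (·.2.2.1) hP
  have n2 := InfoIneq.condMutualInfo_nonneg (·.1) (·.2.1) (·.2.2.2) hP
  have n3 := InfoIneq.mutualInfo_nonneg (·.2.2.1) (·.2.2.2) hP
  have n4 := InfoIneq.mutualInfo_nonneg (·.1) (·.2.2.1) hP
  have n5 := InfoIneq.mutualInfo_le_add (·.1) (·.2.1) (·.2.2.1) hP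
  have key := InfoIneq.mutualInfo_le_of_law (ε := ε) hP hε
  rw [InfoIneq.mutualInfo_map mZ, InfoIneq.mutualInfo_map mZ, InfoIneq.mutualInfo_map mZ,
    InfoIneq.condMutualInfo_map mZ, InfoIneq.condMutualInfo_map mZ,
    InfoIneq.condMutualInfo_map mZ] at key
  rw [InfoIneq.mutualInfo_map mZ, InfoIneq.mutualInfo_map mZ,
    InfoIneq.condMutualInfo_map mZ] at n5
  rw [InfoIneq.condMutualInfo_map mZ] at n1 n2
  rw [InfoIneq.mutualInfo_map mZ] at n3 n4
  simp only at key n1 n2 n3 n4 n5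
  obtain ⟨h₁, h₂⟩ := max_le_iff.1 h
  have hs := Real.sqrt_nonneg ε
  rcases le_total ε 1 with hε1 | hε1
  · have := key hε1 h₁ h₂
    refine ⟨by linarith, fun M _ => ?_⟩
    have : 0 ≤ |M| * √ε * InfoIneq.mutualInfo μ X A := by positivity
    linarith
  · have hs1 : 1 ≤ √ε := Real.one_le_sqrt.2 hε1
    have e1 := mul_le_mul_of_nonneg_right hs1 n4
    have e2 := mul_nonneg hs n4
    refine ⟨by linarith, fun M hM => ?_⟩
    have e3 : ε * InfoIneq.mutualInfo μ X A ≤ |M| * √ε * InfoIneq.mutualInfo μ X A := by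
      refine mul_le_mul_of_nonneg_right ?_ n4
      exact (hM.trans (le_abs_self M)).trans (le_mul_of_one_le_right (abs_nonneg M) hs1)
    linarith
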